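/- Let $F=\langle x_k,\ k\ge 0 \mid x_i^{-1}x_jx_i=x_{j+1}\ \text{for } i<j\rangle$ be Thompson's group. For a finite generating set $X$ of a group $G$, let $\Gamma(G,X)$ be the Cayley graph, in which $g$ is joined to $gs^{\pm1}$ for $s\in X$, and let $B(n)$ be the ball of radius $n$ around the identity in $\Gamma(G,X)$. The group $G$ is called minimally almost convex with respect to $X$ if, for all sufficiently large $n$, any two elements of $B(n)$ at distance two in $\Gamma(G,X)$ can be connected by a path of length at most $2n-1$ lying within $B(n)$. Theorem. Let $j\ge 1$, let $1<i_1<\cdots<i_j$ be integers, and let $X=\{x_0,x_1,x_{i_1},\dots,x_{i_j}\}$, which is a generating set for $F$. Then $F$ is not minimally almost convex with respect to $X$. -/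

import Mathlib

/-- The relators `x_i⁻¹ x_j x_i x_{j+1}⁻¹`, `i < j`, of the standard infinite presentation
of Thompson's group `F`. -/
def thompsonRels : Set (FreeGroup ℕ) :=
  {r | ∃ i j : ℕ, i < j ∧
    r = (FreeGroup.of i)⁻¹ * FreeGroup.of j * FreeGroup.of i * (FreeGroup.of (j + 1))⁻¹}

/-- Thompson's group `F = ⟨x_k, k ≥ 0 | x_i⁻¹ x_j x_i = x_{j+1} if i < j⟩`. -/
abbrev ThompsonF : Type := PresentedGroup thompsonRels

/-- The generator `x_k` of Thompson's group `F`. -/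
def ThompsonF.x (k : ℕ) : ThompsonF := PresentedGroup.of k

/-- The ball `B(n)` of radius `n` around the identity in the Cayley graph `Γ(G, X)`,
in which `g` is joined to `g * s` and to `g * s⁻¹` for `s ∈ X`. -/
def cayleyBall {G : Type*} [Group G] (X : Set G) (n : ℕ) : Set G :=
  {g | (SimpleGraph.mulCayley X).edist 1 g ≤ n}

/-- `G` is minimally almost convex with respect to the generating set `X`: for all sufficiently
large radii `n`, any two elements of `B(n)` at distance two in `Γ(G, X)` can be joined by a path
of length at most `2 n - 1` all of whose vertices lie in `B(n)`.
(Small radii are disregarded, as is usual: for `n = 1` two elements at distance two are never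
joined by a path of length `2 n - 1 = 1`.) -/
def IsMinimallyAlmostConvex {G : Type*} [Group G] (X : Set G) : Prop :=
  ∃ n₀ : ℕ, ∀ n : ℕ, n₀ < n → ∀ g ∈ cayleyBall X n, ∀ h ∈ cayleyBall X n,
    (SimpleGraph.mulCayley X).edist g h = 2 →
      ∃ p : (SimpleGraph.mulCayley X).Walk g h,
        p.length ≤ 2 * n - 1 ∧ ∀ v ∈ p.support, v ∈ cayleyBall X n

/-! Let `K` be the largest index in `X`, `n = 2b + 2`, `g = leftCaret b` and `h = g x_K x_0`. Both
lie in `B(n)`, since `g` commutes with `x_K`. It suffices that every path from `g` to `h` inside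
`B(n)` has length at least `2n`.

Follow the coordinates of `q = 1/2 - b` and `r = K - 1/2` along such a path. That of `q` is integral
at both ends; that of `r` is integral only at `h`, so some edge makes it integral, with value at
most `K`. Making both coordinates integral costs more than `n` steps from the identity
(`not_integral_of_mem_cayleyBall`), so at this edge that of `q` is not integral. But a nonpositive
coordinate moves only under `x_0^{±1}`, so to change integrality it must first be carried past the
origin, about `b` units, and the resulting rise of the `r`-coordinate must be undone
(`le_length_of_not_integral`). This costs about `2b` on each side of the edge. Only the existence of
the action on `ℚ` matters, not its faithfulness. -/

/-- The inverse of the action of `x_{l+1}` on `ℚ`: it expands `[l, l + 1]` to `[l, l + 2]`. -/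
def stretch (l : ℕ) (t : ℚ) : ℚ := if t ≤ l then t else if t ≤ l + 1 then 2 * t - l else t + 1

/-- The action of `x_{l+1}` on `ℚ`: it contracts `[l, l + 2]` to `[l, l + 1]`. -/
def shrink (l : ℕ) (t : ℚ) : ℚ := if t ≤ l then t else if t ≤ l + 2 then (t + l) / 2 else t - 1

/-- The permutation of `ℚ` by which the generator `x_i` of Thompson's group acts. -/
def generatorPerm : ℕ → Equiv.Perm ℚ
  | 0 => Equiv.subRight 1
  | l + 1 =>
    { toFun := shrink l
      invFun := stretch l
      left_inv := fun t => by simp only [shrink, stretch]; split_ifs <;> linarith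
      right_inv := fun t => by simp only [shrink, stretch]; split_ifs <;> linarith }

theorem generatorPerm_zero_apply (t : ℚ) : generatorPerm 0 t = t - 1 := rfl

theorem generatorPerm_succ_apply (l : ℕ) (t : ℚ) : generatorPerm (l + 1) t = shrink l t := rfl

theorem generatorPerm_zero_inv_apply (t : ℚ) : (generatorPerm 0)⁻¹ t = t + 1 := rfl

theorem generatorPerm_succ_inv_apply (l : ℕ) (t : ℚ) : (generatorPerm (l + 1))⁻¹ t = stretch l t :=
  rfl

theorem generatorPerm_mul_comm {i j : ℕ} (h : i < j) :
    generatorPerm j * generatorPerm i = generatorPerm i * generatorPerm (j + 1) := by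
  obtain ⟨m, rfl⟩ : ∃ m, j = m + 1 := ⟨j - 1, by omega⟩
  ext t
  rcases i with _ | l
  · simp only [Equiv.Perm.mul_apply, generatorPerm_zero_apply, generatorPerm_succ_apply, shrink]
    push_cast
    split_ifs <;> linarith
  · have hl : (l : ℚ) + 1 ≤ m := by exact_mod_cast Nat.lt_of_succ_lt_succ h
    simp only [Equiv.Perm.mul_apply, generatorPerm_succ_apply, shrink]
    push_cast
    split_ifs <;> linarith

/-- The action of Thompson's group on `ℚ` by piecewise linear homeomorphisms. -/
def thompsonAction : ThompsonF →* Equiv.Perm ℚ :=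
  PresentedGroup.toGroup (f := generatorPerm) (by
    rintro r ⟨i, j, hij, rfl⟩
    simp only [map_mul, map_inv, FreeGroup.lift_apply_of]
    rw [mul_assoc _ _ (generatorPerm i), generatorPerm_mul_comm hij]
    group)

theorem thompsonAction_x (k : ℕ) : thompsonAction (ThompsonF.x k) = generatorPerm k :=
  PresentedGroup.toGroup.of _

theorem ThompsonF.x_mul_x {i j : ℕ} (h : i < j) :
    ThompsonF.x j * ThompsonF.x i = ThompsonF.x i * ThompsonF.x (j + 1) := by
  have : ((FreeGroup.of i)⁻¹ * FreeGroup.of j * FreeGroup.of i * (FreeGroup.of (j + 1))⁻¹ :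
      FreeGroup ℕ) ∈ thompsonRels := ⟨i, j, h, rfl⟩
  have h1 := PresentedGroup.one_of_mem this
  simp only [map_mul, map_inv] at h1
  change (ThompsonF.x i)⁻¹ * ThompsonF.x j * ThompsonF.x i * (ThompsonF.x (j + 1))⁻¹ = 1 at h1
  rw [mul_inv_eq_one, mul_assoc, inv_mul_eq_iff_eq_mul] at h1
  exact h1

theorem ThompsonF.x_mul_x_zero_pow {j : ℕ} (h : 0 < j) (a : ℕ) :
    ThompsonF.x j * ThompsonF.x 0 ^ a = ThompsonF.x 0 ^ a * ThompsonF.x (j + a) := by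
  induction a with
  | zero => simp
  | succ a ih =>
    rw [pow_succ, ← mul_assoc, ih, mul_assoc, ThompsonF.x_mul_x (by omega), ← mul_assoc]
    rfl

/-! ### Coordinates and their change along an edge -/

/-- The coordinate of `q` seen from `f`, that is the preimage of `q` under the action of `f`. -/
def coord (q : ℚ) (f : ThompsonF) : ℚ := (thompsonAction f)⁻¹ q

theorem coord_one (q : ℚ) : coord q 1 = q := by simp [coord]

theorem coord_mul (q : ℚ) (f s : ThompsonF) :
    coord q (f * s) = (thompsonAction s)⁻¹ (coord q f) := by
  simp [coord, mul_inv_rev]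

theorem coord_mul_x_zero (q : ℚ) (f : ThompsonF) :
    coord q (f * ThompsonF.x 0) = coord q f + 1 := by
  rw [coord_mul, thompsonAction_x, generatorPerm_zero_inv_apply]

theorem coord_mul_x_succ (q : ℚ) (f : ThompsonF) (l : ℕ) :
    coord q (f * ThompsonF.x (l + 1)) = stretch l (coord q f) := by
  rw [coord_mul, thompsonAction_x, generatorPerm_succ_inv_apply]

theorem coord_mul_x_zero_inv (q : ℚ) (f : ThompsonF) :
    coord q (f * (ThompsonF.x 0)⁻¹) = coord q f - 1 := by
  rw [coord_mul, map_inv, inv_inv, thompsonAction_x, generatorPerm_zero_apply]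

theorem coord_mul_x_succ_inv (q : ℚ) (f : ThompsonF) (l : ℕ) :
    coord q (f * (ThompsonF.x (l + 1))⁻¹) = shrink l (coord q f) := by
  rw [coord_mul, map_inv, inv_inv, thompsonAction_x, generatorPerm_succ_apply]

theorem coord_mul_x_zero_pow (q : ℚ) (f : ThompsonF) (a : ℕ) :
    coord q (f * ThompsonF.x 0 ^ a) = coord q f + a := by
  induction a with
  | zero => simp
  | succ a ih => rw [pow_succ, ← mul_assoc, coord_mul_x_zero, ih]; push_cast; ring

theorem coord_mul_x_zero_inv_pow (q : ℚ) (f : ThompsonF) (a : ℕ) :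
    coord q (f * (ThompsonF.x 0)⁻¹ ^ a) = coord q f - a := by
  induction a with
  | zero => simp
  | succ a ih => rw [pow_succ, ← mul_assoc, coord_mul_x_zero_inv, ih]; push_cast; ring

/-- The effect of multiplication by a generator `x_i^{±1}`, `i ≤ K`, on coordinates. -/
def CoordStep (K : ℕ) (φ : ℚ → ℚ) : Prop :=
  (φ = fun t => t + 1) ∨ (φ = fun t => t - 1) ∨ ∃ l < K, φ = stretch l ∨ φ = shrink l

theorem exists_coordStep_of_adj {X : Set ThompsonF} {K : ℕ}
    (hX : ∀ s ∈ X, ∃ i ≤ K, s = ThompsonF.x i) {f f' : ThompsonF}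
    (h : (SimpleGraph.mulCayley X).Adj f f') :
    ∃ φ, CoordStep K φ ∧ ∀ q, coord q f' = φ (coord q f) := by
  rw [SimpleGraph.mulCayley_adj'] at h
  obtain ⟨-, s, hs, h⟩ := h
  obtain ⟨i, hi, rfl⟩ := hX s hs
  rcases h with rfl | rfl <;> rcases i with _ | l
  · exact ⟨_, Or.inl rfl, fun q => coord_mul_x_zero q f⟩
  · exact ⟨_, Or.inr (Or.inr ⟨l, hi, Or.inl rfl⟩), fun q => coord_mul_x_succ q f l⟩
  · exact ⟨_, Or.inr (Or.inl rfl), fun q => by rw [coord_mul_x_zero]; ring⟩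
  · refine ⟨_, Or.inr (Or.inr ⟨l, hi, Or.inr rfl⟩), fun q => ?_⟩
    rw [← coord_mul_x_succ_inv, mul_inv_cancel_right]

/-! ### Integrality of coordinates -/

/-- A rational number is integral. -/
def IsIntegralRat (t : ℚ) : Prop := ∃ m : ℤ, t = m

theorem isIntegralRat_add_one {t : ℚ} : IsIntegralRat (t + 1) ↔ IsIntegralRat t :=
  ⟨fun ⟨m, h⟩ => ⟨m - 1, by push_cast; linarith⟩, fun ⟨m, h⟩ => ⟨m + 1, by push_cast; linarith⟩⟩

theorem isIntegralRat_sub_one {t : ℚ} : IsIntegralRat (t - 1) ↔ IsIntegralRat t := by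
  rw [← isIntegralRat_add_one, sub_add_cancel]

theorem not_isIntegralRat_intCast_add_half (m : ℤ) : ¬ IsIntegralRat ((m : ℚ) + 1 / 2) := by
  rintro ⟨a, h⟩
  have : 2 * m + 1 = 2 * a := by
    have : (2 : ℚ) * m + 1 = 2 * a := by linarith
    exact_mod_cast this
  omega

theorem IsIntegralRat.stretch {t : ℚ} (h : IsIntegralRat t) (l : ℕ) :
    IsIntegralRat (stretch l t) := by
  obtain ⟨m, rfl⟩ := h
  unfold _root_.stretch
  split_ifs
  · exact ⟨m, rfl⟩
  · exact ⟨2 * m - l, by push_cast; ring⟩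
  · exact ⟨m + 1, by push_cast; ring⟩

theorem isIntegralRat_of_shrink {t : ℚ} {l : ℕ} (h : IsIntegralRat (shrink l t)) :
    IsIntegralRat t := by
  obtain ⟨m, h⟩ := h
  unfold shrink at h
  split_ifs at h
  · exact ⟨m, h⟩
  · exact ⟨2 * m - l, by push_cast; linarith⟩
  · exact ⟨m + 1, by push_cast; linarith⟩

/-- Off `[l, l + 1]` the map is a translation by an integer; on it the slope is 2, and the only
integer value not coming from an integer is `l + 1`, at the midpoint. -/
theorem eq_add_half_of_stretch {t : ℚ} {l : ℕ} (ht : ¬ IsIntegralRat t)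
    (h : IsIntegralRat (stretch l t)) : t = l + 1 / 2 := by
  obtain ⟨m, h⟩ := h
  unfold stretch at h
  split_ifs at h with h1 h2
  · exact absurd ⟨m, h⟩ ht
  · have h3 : (l : ℤ) < m := by
      have : ((l : ℤ) : ℚ) < m := by push_cast; linarith
      exact_mod_cast this
    have h4 : m ≤ (l : ℤ) + 2 := by
      have : (m : ℚ) ≤ ((l + 2 : ℤ) : ℚ) := by push_cast; linarith
      exact_mod_cast this
    obtain rfl | rfl : m = l + 1 ∨ m = l + 2 := by omega
    · push_cast at h; linarith
    · exact absurd ⟨l + 1, by push_cast at h ⊢; linarith⟩ ht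
  · exact absurd ⟨m - 1, by push_cast; linarith⟩ ht

theorem CoordStep.integral_or {K : ℕ} {φ : ℚ → ℚ} (hφ : CoordStep K φ) {t : ℚ}
    (h : IsIntegralRat (φ t)) :
    IsIntegralRat t ∨ ∃ l < K, φ = stretch l ∧ t = l + 1 / 2 := by
  rcases hφ with rfl | rfl | ⟨l, hl, rfl | rfl⟩
  · exact Or.inl (isIntegralRat_add_one.1 h)
  · exact Or.inl (isIntegralRat_sub_one.1 h)
  · by_cases ht : IsIntegralRat t
    · exact Or.inl ht
    · exact Or.inr ⟨l, hl, rfl, eq_add_half_of_stretch ht h⟩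
  · exact Or.inl (isIntegralRat_of_shrink h)

theorem stretch_add_half (l : ℕ) : stretch l (l + 1 / 2) = l + 1 := by
  unfold stretch
  split_ifs <;> linarith

theorem stretch_lt_stretch (l : ℕ) {s t : ℚ} (h : s < t) : stretch l s < stretch l t := by
  unfold stretch
  split_ifs <;> linarith

theorem shrink_lt_shrink (l : ℕ) {s t : ℚ} (h : s < t) : shrink l s < shrink l t := by
  unfold shrink
  split_ifs <;> linarith

theorem le_stretch (l : ℕ) (t : ℚ) : t ≤ stretch l t := by
  unfold stretch
  split_ifs <;> linarith

theorem add_half_le_stretch {l : ℕ} {t : ℚ} (h : l + 1 / 2 ≤ t) : t + 1 / 2 ≤ stretch l t := by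
  unfold stretch
  split_ifs <;> linarith

theorem sub_one_le_shrink (l : ℕ) (t : ℚ) : t - 1 ≤ shrink l t := by
  unfold shrink
  split_ifs <;> linarith

theorem stretch_of_nonpos (l : ℕ) {t : ℚ} (h : t ≤ 0) : stretch l t = t :=
  if_pos (h.trans l.cast_nonneg)

theorem shrink_of_nonpos (l : ℕ) {t : ℚ} (h : t ≤ 0) : shrink l t = t :=
  if_pos (h.trans l.cast_nonneg)

theorem CoordStep.strictMono {K : ℕ} {φ : ℚ → ℚ} (hφ : CoordStep K φ) : StrictMono φ := by
  intro s t h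
  rcases hφ with rfl | rfl | ⟨l, -, rfl | rfl⟩
  · simpa using h
  · simpa using h
  · exact stretch_lt_stretch l h
  · exact shrink_lt_shrink l h

theorem CoordStep.sub_one_le {K : ℕ} {φ : ℚ → ℚ} (hφ : CoordStep K φ) (t : ℚ) : t - 1 ≤ φ t := by
  rcases hφ with rfl | rfl | ⟨l, -, rfl | rfl⟩
  · dsimp only; linarith
  · exact le_rfl
  · linarith [le_stretch l t]
  · exact sub_one_le_shrink l t

/-! ### The potential -/

open Classical in
/-- The bonus `3 / 2` granted to integral coordinates. -/
noncomputable def integralBonus (t : ℚ) : ℚ := if IsIntegralRat t then 3 / 2 else 0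

theorem integralBonus_eq_of_iff {s t : ℚ} (h : IsIntegralRat s ↔ IsIntegralRat t) :
    integralBonus s = integralBonus t := by
  unfold integralBonus
  by_cases hs : IsIntegralRat s
  · rw [if_pos hs, if_pos (h.1 hs)]
  · rw [if_neg hs, if_neg (mt h.2 hs)]

theorem CoordStep.integralBonus_le {K : ℕ} {φ : ℚ → ℚ} (hφ : CoordStep K φ) (t : ℚ) :
    integralBonus (φ t) ≤ integralBonus t ∨
      integralBonus (φ t) ≤ integralBonus t + 3 / 2 ∧ ∃ l < K, φ = stretch l ∧ t = l + 1 / 2 := by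
  unfold integralBonus
  by_cases h : IsIntegralRat (φ t)
  · rcases hφ.integral_or h with h' | h'
    · left; rw [if_pos h, if_pos h']
    · right; refine ⟨?_, h'⟩; split_ifs <;> norm_num
  · left; rw [if_neg h]; split_ifs <;> norm_num

/-- A step that makes a coordinate integral is some `stretch l` at `l + 1/2 ≤ z`, so it also raises
`z` by at least `1/2`; hence the value `3/2 = 1 + 1/2` of the bonus. One step cannot do this to both
coordinates, as they are distinct. -/
theorem CoordStep.integralBonus_add_le {K : ℕ} {φ : ℚ → ℚ} (hφ : CoordStep K φ) {y z : ℚ}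
    (hyz : y < z) :
    integralBonus (φ y) + integralBonus (φ z) - φ z ≤ integralBonus y + integralBonus z - z + 1 := by
  rcases hφ.integralBonus_le y with hy | ⟨hy, l, -, hl, rfl⟩ <;>
    rcases hφ.integralBonus_le z with hz | ⟨hz, l', -, hl', rfl⟩
  · linarith [hφ.sub_one_le z]
  · subst hl'
    rw [stretch_add_half] at hz ⊢
    linarith
  · subst hl
    linarith [add_half_le_stretch hyz.le]
  · have h1 : (l : ℚ) < l' := by linarith
    subst hl
    have h2 := stretch_add_half l'
    rw [← hl'] at h2
    have h3 : stretch l ((l' : ℚ) + 1 / 2) = (l' : ℚ) + 1 / 2 + 1 := by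
      have : (l : ℚ) + 1 ≤ l' := by exact_mod_cast h1
      unfold stretch
      split_ifs <;> linarith
    linarith

/-- The potential of a pair of coordinates, which grows by at most one in every step. -/
noncomputable def potential (c y z : ℚ) : ℚ := c * (integralBonus y + integralBonus z) - z

/-- Convex combination of the case `c = 1` (`integralBonus_add_le`) and the case `c = 0`
(`sub_one_le`). -/
theorem CoordStep.potential_le {K : ℕ} {φ : ℚ → ℚ} (hφ : CoordStep K φ) {c y z : ℚ}
    (hc0 : 0 ≤ c) (hc1 : c ≤ 1) (hyz : y < z) :
    potential c (φ y) (φ z) ≤ potential c y z + 1 := by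
  have h1 := mul_le_mul_of_nonneg_left (hφ.integralBonus_add_le hyz) hc0
  have h2 := mul_le_mul_of_nonneg_left (hφ.sub_one_le z) (sub_nonneg.2 hc1)
  unfold potential
  linarith

theorem potential_add_one (c y z : ℚ) : potential c (y + 1) (z + 1) = potential c y z - 1 := by
  unfold potential
  rw [integralBonus_eq_of_iff isIntegralRat_add_one, integralBonus_eq_of_iff isIntegralRat_add_one]
  ring

/-! ### Lower bounds for the length of walks -/

theorem SimpleGraph.Walk.induction_length {V : Type*} {G : SimpleGraph V} {P : ℕ → V → Prop}
    (hP : ∀ n u v, P n u → G.Adj u v → P (n + 1) v) {u v : V} (p : G.Walk u v) :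
    ∀ n, P n u → P (n + p.length) v := by
  induction p with
  | nil => exact fun n h => h
  | cons h p ih =>
    intro n hn
    rw [SimpleGraph.Walk.length_cons, add_comm p.length, ← add_assoc]
    exact ih _ (hP _ _ _ hn h)

theorem SimpleGraph.Walk.exists_adj_crossing {V : Type*} {G : SimpleGraph V} (P : V → Prop)
    {u v : V} (p : G.Walk u v) (hu : ¬ P u) (hv : P v) :
    ∃ (a b : V) (p₁ : G.Walk u a) (p₂ : G.Walk b v), G.Adj a b ∧ ¬ P a ∧ P b ∧ b ∈ p.support ∧
      p.length = p₁.length + 1 + p₂.length := by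
  induction p with
  | nil => exact absurd hv hu
  | @cons u w v h p ih =>
    by_cases hw : P w
    · exact ⟨u, w, .nil, p, h, hu, hw, by simp, by simp [add_comm]⟩
    · obtain ⟨a, b, p₁, p₂, hab, ha, hb, hs, hl⟩ := ih hw hv
      exact ⟨a, b, .cons h p₁, p₂, hab, ha, hb, by simp [hs], by simp [hl]; omega⟩

theorem SimpleGraph.Walk.eq_or_eq_of_length_le_one {V : Type*} {G : SimpleGraph V} {u v : V}
    (p : G.Walk u v) (hp : p.length ≤ 1) {w : V} (hw : w ∈ p.support) : w = u ∨ w = v := by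
  match p, hp, hw with
  | .nil, _, hw => simpa using hw
  | .cons _ .nil, _, hw => simpa using hw
  | .cons _ (.cons _ _), hp, _ => simp at hp

/-- A walk along which a coordinate `y ≤ 0` congruent to `e` modulo `1` becomes incongruent to `e`
has to raise `y` to `e` first. -/
theorem le_length_of_not_integral {X : Set ThompsonF} {K : ℕ}
    (hX : ∀ s ∈ X, ∃ i ≤ K, s = ThompsonF.x i) {q r : ℚ} {c e : ℚ} (hc0 : 0 ≤ c)
    (hc1 : c ≤ 1) (he0 : 0 < e) (he1 : e ≤ 1) {f f' : ThompsonF}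
    (p : (SimpleGraph.mulCayley X).Walk f f') (hlt : coord q f < coord r f) (hf0 : coord q f ≤ 0)
    (hf : IsIntegralRat (coord q f - e)) (hf' : ¬ IsIntegralRat (coord q f' - e)) :
    2 * (e - coord q f) + potential c (coord q f') (coord r f')
      - potential c (coord q f) (coord r f) ≤ p.length := by
  let P : ℕ → ThompsonF → Prop := fun n v => coord q v < coord r v ∧
    ((coord q v ≤ 0 ∧ IsIntegralRat (coord q v - e) ∧
      2 * (coord q v - coord q f) + potential c (coord q v) (coord r v)
        - potential c (coord q f) (coord r f) ≤ n) ∨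
    2 * (e - coord q f) + potential c (coord q v) (coord r v)
      - potential c (coord q f) (coord r f) ≤ n)
  have hP : P (0 + p.length) f' := by
    refine p.induction_length (P := P) ?_ 0 ⟨hlt, Or.inl ⟨hf0, hf, by simp⟩⟩
    rintro n v w ⟨hvlt, hv⟩ hvw
    obtain ⟨φ, hφ, hw⟩ := exists_coordStep_of_adj hX hvw
    have hpot := hφ.potential_le hc0 hc1 hvlt
    simp only [P, hw]
    refine ⟨hφ.strictMono hvlt, ?_⟩
    push_cast
    rcases hv with ⟨h0, ⟨m, hm⟩, hn⟩ | hn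
    · rcases hφ with rfl | rfl | ⟨l, -, rfl | rfl⟩
      -- The step `x_0` raises `y` by 1 and lowers the potential by 1, so `2 y + potential` still
      -- grows by at most 1: this is the source of the factor 2.
      · dsimp only
        rw [potential_add_one]
        by_cases h1 : coord q v + 1 ≤ 0
        · exact Or.inl ⟨h1, ⟨m + 1, by push_cast; linarith⟩, by linarith⟩
        -- Since `-1 < y ≤ 0` and `0 < e ≤ 1`, the congruence forces `y + 1 = e`: the coordinate
        -- cannot become positive without landing on `e`.
        · have hm1 : m = -1 := by
            have h2 : (m : ℚ) < 0 := by linarith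
            have h3 : (-2 : ℚ) < m := by linarith
            have h2' : m < 0 := by exact_mod_cast h2
            have h3' : -2 < m := by exact_mod_cast h3
            omega
          rw [hm1] at hm
          push_cast at hm
          right
          linarith
      · exact Or.inl ⟨by linarith, ⟨m - 1, by push_cast; linarith⟩, by linarith⟩
      · rw [stretch_of_nonpos l h0] at hpot ⊢
        exact Or.inl ⟨h0, ⟨m, hm⟩, by linarith⟩
      · rw [shrink_of_nonpos l h0] at hpot ⊢
        exact Or.inl ⟨h0, ⟨m, hm⟩, by linarith⟩
    · right
      linarith
  rw [zero_add] at hP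
  rcases hP.2 with h | h
  · exact absurd h.2.1 hf'
  · exact h

/-! ### Balls and the two endpoints -/

theorem edist_mul_le_one {G : Type*} [Group G] {X : Set G} {s : G} (hs : s ∈ X) (f : G) :
    (SimpleGraph.mulCayley X).edist f (f * s) ≤ 1 := by
  by_cases h : f = f * s
  · rw [← h]; simp
  · have hadj : (SimpleGraph.mulCayley X).Adj f (f * s) := by
      rw [SimpleGraph.mulCayley_adj']
      exact ⟨h, s, hs, Or.inl rfl⟩
    simpa using hadj.toWalk.edist_le

theorem edist_mul_inv_le_one {G : Type*} [Group G] {X : Set G} {s : G} (hs : s ∈ X) (f : G) :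
    (SimpleGraph.mulCayley X).edist f (f * s⁻¹) ≤ 1 := by
  simpa [SimpleGraph.edist_comm] using edist_mul_le_one hs (f * s⁻¹)

theorem cayleyBall_mul {G : Type*} [Group G] {X : Set G} {n : ℕ} {f s : G}
    (hf : f ∈ cayleyBall X n) (hs : s ∈ X) : f * s ∈ cayleyBall X (n + 1) := by
  have h : (SimpleGraph.mulCayley X).edist 1 (f * s) ≤ n + 1 :=
    SimpleGraph.edist_triangle.trans (add_le_add hf (edist_mul_le_one hs f))
  simpa [cayleyBall] using h

theorem cayleyBall_mul_inv {G : Type*} [Group G] {X : Set G} {n : ℕ} {f s : G}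
    (hf : f ∈ cayleyBall X n) (hs : s ∈ X) : f * s⁻¹ ∈ cayleyBall X (n + 1) := by
  have h : (SimpleGraph.mulCayley X).edist 1 (f * s⁻¹) ≤ n + 1 :=
    SimpleGraph.edist_triangle.trans (add_le_add hf (edist_mul_inv_le_one hs f))
  simpa [cayleyBall] using h

theorem cayleyBall_mul_pow {G : Type*} [Group G] {X : Set G} {n : ℕ} {f s : G}
    (hf : f ∈ cayleyBall X n) (hs : s ∈ X) (a : ℕ) : f * s ^ a ∈ cayleyBall X (n + a) := by
  induction a with
  | zero => simpa using hf
  | succ a ih => rw [pow_succ, ← mul_assoc]; exact cayleyBall_mul ih hs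

theorem cayleyBall_mul_inv_pow {G : Type*} [Group G] {X : Set G} {n : ℕ} {f s : G}
    (hf : f ∈ cayleyBall X n) (hs : s ∈ X) (a : ℕ) : f * s⁻¹ ^ a ∈ cayleyBall X (n + a) := by
  induction a with
  | zero => simpa using hf
  | succ a ih => rw [pow_succ s⁻¹, ← mul_assoc]; exact cayleyBall_mul_inv ih hs

theorem one_mem_cayleyBall {G : Type*} [Group G] (X : Set G) (n : ℕ) : 1 ∈ cayleyBall X n := by
  simp [cayleyBall]

/-- The element `x_0^b x_1 x_0^{-(b+1)}`, supported to the left of the origin. -/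
def leftCaret (b : ℕ) : ThompsonF :=
  ThompsonF.x 0 ^ b * ThompsonF.x 1 * (ThompsonF.x 0)⁻¹ ^ (b + 1)

/-- Moving `x_K` leftwards, `x_0^{-(b+1)}` raises its index to `K + b + 1`, `x_1` lowers it to `K +
b` (which exceeds 1 because `b ≥ 1`), and `x_0^b` restores `K`. -/
theorem leftCaret_mul_x (b : ℕ) {K : ℕ} (hb : 1 ≤ b) (hK : 1 ≤ K) :
    leftCaret b * ThompsonF.x K = ThompsonF.x K * leftCaret b := by
  have h1 := ThompsonF.x_mul_x_zero_pow (j := K) (by omega) (b + 1)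
  have h2 := ThompsonF.x_mul_x_zero_pow (j := K) (by omega) b
  have h3 := ThompsonF.x_mul_x (i := 1) (j := K + b) (by omega)
  have h4 : (ThompsonF.x 0)⁻¹ ^ (b + 1) * ThompsonF.x K
      = ThompsonF.x (K + (b + 1)) * (ThompsonF.x 0)⁻¹ ^ (b + 1) := by
    rw [inv_pow, inv_mul_eq_iff_eq_mul, ← mul_assoc, ← h1, mul_inv_cancel_right]
  unfold leftCaret
  calc _ = ThompsonF.x 0 ^ b * (ThompsonF.x 1 * ThompsonF.x (K + b + 1))
        * (ThompsonF.x 0)⁻¹ ^ (b + 1) := by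
        rw [mul_assoc _ _ (ThompsonF.x K), h4]; simp only [mul_assoc, add_assoc]
    _ = (ThompsonF.x K * ThompsonF.x 0 ^ b) * ThompsonF.x 1 * (ThompsonF.x 0)⁻¹ ^ (b + 1) := by
        rw [← h3, h2]; simp only [mul_assoc]
    _ = _ := by simp only [mul_assoc]

theorem coord_leftCaret (q : ℚ) (b : ℕ) :
    coord q (leftCaret b) = stretch 0 (q + b) - (b + 1) := by
  unfold leftCaret
  rw [coord_mul_x_zero_inv_pow, coord_mul_x_succ, ← one_mul (ThompsonF.x 0 ^ b),
    coord_mul_x_zero_pow, coord_one]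
  push_cast
  rfl

/-- If the right coordinate `r = K - 1/2` turns integral within the ball of radius `2 b + 2`, then
the left coordinate `q = 1/2 - b` is not integral. -/
theorem not_integral_of_mem_cayleyBall {X : Set ThompsonF} {K b : ℕ}
    (hX : ∀ s ∈ X, ∃ i ≤ K, s = ThompsonF.x i) (hb : 1 ≤ b) (hK : 1 ≤ K)
    {f : ThompsonF}     (hf : f ∈ cayleyBall X (2 * b + 2)) (hz : IsIntegralRat (coord (K - 1 / 2) f))
    (hzK : coord (K - 1 / 2) f ≤ K) : ¬ IsIntegralRat (coord (1 / 2 - b) f) := by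
  intro hy
  have hb' : (1 : ℚ) ≤ b := by exact_mod_cast hb
  have hK' : (1 : ℚ) ≤ K := by exact_mod_cast hK
  have hne : (SimpleGraph.mulCayley X).edist 1 f ≠ ⊤ :=
    ne_top_of_le_ne_top (ENat.natCast_ne_top _) hf
  obtain ⟨p, hp⟩ := SimpleGraph.exists_walk_of_edist_ne_top hne
  have hlen : p.length ≤ 2 * b + 2 := by
    have : (p.length : ℕ∞) ≤ ((2 * b + 2 : ℕ) : ℕ∞) := hp ▸ hf
    exact_mod_cast this
  have hlen' : (p.length : ℚ) ≤ 2 * b + 2 := by exact_mod_cast hlen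
  have hq : ¬ IsIntegralRat (1 / 2 - b : ℚ) := by
    have := not_isIntegralRat_intCast_add_half (-b)
    push_cast at this
    rwa [neg_add_eq_sub] at this
  have hr : ¬ IsIntegralRat (K - 1 / 2 : ℚ) := by
    have := not_isIntegralRat_intCast_add_half (K - 1)
    push_cast at this
    convert this using 1
    ring_nf
  -- Carrying `q` up to `e = 1/2` costs `2b`, the two bonuses add 3, and the rise of the other
  -- coordinate from `K - 1/2` gives back at most `1/2`: in total at least `2b + 5/2 > 2b + 2`.
  have key := le_length_of_not_integral hX (q := 1 / 2 - b) (r := K - 1 / 2)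
    (c := 1) (e := 1 / 2) (by norm_num) le_rfl (by norm_num) (by norm_num) p
    (by simp only [coord_one]; linarith) (by simp only [coord_one]; linarith)
    ⟨-b, by simp [coord_one]⟩ (by
      rintro ⟨m, hm⟩
      obtain ⟨a, ha⟩ := hy
      exact not_isIntegralRat_intCast_add_half m ⟨a, by linarith⟩)
  rw [coord_one, coord_one, potential, potential, integralBonus, if_pos hy, integralBonus, if_pos hz,
    integralBonus, if_neg hq, integralBonus, if_neg hr] at key
  linarith

theorem le_length_of_support_subset_cayleyBall {X : Set ThompsonF} {K b : ℕ}
    (hX : ∀ s ∈ X, ∃ i ≤ K, s = ThompsonF.x i) (hb : 1 ≤ b) (hK : 1 ≤ K)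
    (p : (SimpleGraph.mulCayley X).Walk (leftCaret b)
      (leftCaret b * ThompsonF.x K * ThompsonF.x 0))
    (hp : ∀ v ∈ p.support, v ∈ cayleyBall X (2 * b + 2)) : 4 * b + 4 ≤ p.length := by
  have hb' : (1 : ℚ) ≤ b := by exact_mod_cast hb
  have hK' : (1 : ℚ) ≤ K := by exact_mod_cast hK
  obtain ⟨l, rfl⟩ : ∃ l, K = l + 1 := ⟨K - 1, by omega⟩
  push_cast at hK'
  have hl0 : (0 : ℚ) ≤ l := l.cast_nonneg
  set q : ℚ := 1 / 2 - b with hq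
  set r : ℚ := ((l + 1 : ℕ) : ℚ) - 1 / 2 with hr
  have hr' : r = l + 1 / 2 := by rw [hr]; push_cast; ring
  have hqg : coord q (leftCaret b) = -b := by
    rw [coord_leftCaret, hq, stretch]
    push_cast
    split_ifs <;> linarith
  have hrg : coord r (leftCaret b) = r := by
    rw [coord_leftCaret, hr', stretch]
    push_cast
    split_ifs <;> linarith
  have hqh : coord q (leftCaret b * ThompsonF.x (l + 1) * ThompsonF.x 0) = -b + 1 := by
    rw [coord_mul_x_zero, coord_mul_x_succ, hqg, stretch_of_nonpos l (by linarith)]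
  have hrh : coord r (leftCaret b * ThompsonF.x (l + 1) * ThompsonF.x 0) = l + 2 := by
    rw [coord_mul_x_zero, coord_mul_x_succ, hrg, hr', stretch_add_half]; ring
  obtain ⟨v, w, p₁, p₂, hvw, hv, hw, hwp, hlen⟩ :=
    p.exists_adj_crossing (fun f => IsIntegralRat (coord r f))
      (by rw [hrg, hr']; exact_mod_cast not_isIntegralRat_intCast_add_half l)
      (by rw [hrh]; exact ⟨l + 2, by push_cast; ring⟩)
  obtain ⟨φ, hφ, hφvw⟩ := exists_coordStep_of_adj hX hvw
  rw [hφvw] at hw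
  obtain h | ⟨i, hi, rfl, hvi⟩ := hφ.integral_or hw
  · exact absurd h hv
  rw [← hφvw] at hw
  have hi' : (i : ℚ) ≤ l := by exact_mod_cast Nat.lt_succ_iff.1 hi
  have hwi : coord r w = i + 1 := by rw [hφvw, hvi, stretch_add_half]
  have hyw : ¬ IsIntegralRat (coord q w) :=
    not_integral_of_mem_cayleyBall hX hb hK (hp w hwp) hw (by rw [← hr, hwi]; push_cast; linarith)
  have hyv : ¬ IsIntegralRat (coord q v) := fun h => hyw (by rw [hφvw]; exact h.stretch i)
  -- On both sides of the crossing edge `c = 0` suffices: the potential is then just `-z`. The walk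
  -- `p₂` is reversed so that it too starts with an integral left coordinate.
  have h₁ := le_length_of_not_integral hX (q := q) (r := r) (c := 0) (e := 1) le_rfl
    (by norm_num) (by norm_num) le_rfl p₁ (by rw [hqg, hrg, hr']; linarith) (by rw [hqg]; linarith)
    ⟨-b - 1, by rw [hqg]; push_cast; ring⟩ (by rwa [isIntegralRat_sub_one])
  have h₂ := le_length_of_not_integral hX (q := q) (r := r) (c := 0) (e := 1) le_rfl
    (by norm_num) (by norm_num) le_rfl p₂.reverse (by rw [hqh, hrh]; linarith)
    (by rw [hqh]; linarith) ⟨-b, by rw [hqh]; push_cast; ring⟩ (by rwa [isIntegralRat_sub_one])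
  simp only [potential, hqg, hrg, hvi, hqh, hrh, hwi, SimpleGraph.Walk.length_reverse] at h₁ h₂
  -- The pieces have lengths at least `2b + 2 + (l - i)` and `2b + 1 + (l - i)`; the crossing edge
  -- adds 1.
  have : ((4 * b + 4 : ℕ) : ℚ) ≤ p.length := by rw [hlen]; push_cast; linarith
  exact_mod_cast this

theorem not_isMinimallyAlmostConvex {X : Set ThompsonF} {K : ℕ} (hK : 1 ≤ K)
    (hX : ∀ s ∈ X, ∃ i ≤ K, s = ThompsonF.x i) (h0 : ThompsonF.x 0 ∈ X) (h1 : ThompsonF.x 1 ∈ X)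
    (hKX : ThompsonF.x K ∈ X) : ¬ IsMinimallyAlmostConvex X := by
  rintro ⟨n₀, h⟩
  obtain ⟨b, hb, hn⟩ : ∃ b, 1 ≤ b ∧ n₀ < 2 * b + 2 := ⟨n₀ + 1, by omega, by omega⟩
  set g := leftCaret b with hg
  set m := g * ThompsonF.x K with hm
  have hgmem : g ∈ cayleyBall X (2 * b + 2) := by
    have := cayleyBall_mul_inv_pow (cayleyBall_mul
      (cayleyBall_mul_pow (one_mem_cayleyBall X 0) h0 b) h1) h0 (b + 1)
    rw [one_mul] at this
    rw [hg, leftCaret]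
    convert this using 2
    omega
  have hhmem : m * ThompsonF.x 0 ∈ cayleyBall X (2 * b + 2) := by
    have := cayleyBall_mul_inv_pow (cayleyBall_mul
      (cayleyBall_mul_pow (cayleyBall_mul (one_mem_cayleyBall X 0) hKX) h0 b) h1) h0 b
    -- After commuting `x_K` to the front, the final `x_0` cancels, which shortens the word from `2b
    -- + 4` to `2b + 2` letters.
    have heq : m * ThompsonF.x 0
        = 1 * ThompsonF.x K * ThompsonF.x 0 ^ b * ThompsonF.x 1 * (ThompsonF.x 0)⁻¹ ^ b := by
      rw [hm, hg, leftCaret_mul_x b hb hK, leftCaret, pow_succ]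
      group
    rw [heq]
    convert this using 2
    omega
  have hle : (SimpleGraph.mulCayley X).edist g (m * ThompsonF.x 0) ≤ 2 := by
    refine SimpleGraph.edist_triangle.trans
      ((add_le_add (edist_mul_le_one hKX g) (edist_mul_le_one h0 m)).trans ?_)
    norm_num
  have hdist : (SimpleGraph.mulCayley X).edist g (m * ThompsonF.x 0) = 2 := by
    obtain ⟨p, hp⟩ := SimpleGraph.exists_walk_of_edist_ne_top
      (ne_top_of_le_ne_top (by simp) hle)
    rw [← hp] at hle ⊢
    have hle' : p.length ≤ 2 := by exact_mod_cast hle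
    -- A walk of length at most 1 has only its endpoints as vertices, so it stays in the ball and
    -- the bound `4b + 4` rules it out.
    by_contra hne
    have hlt : p.length ≤ 1 := by
      have : p.length ≠ 2 := fun h => hne (by rw [h]; rfl)
      omega
    have := le_length_of_support_subset_cayleyBall hX hb hK p (by
      intro v hv
      rcases p.eq_or_eq_of_length_le_one hlt hv with rfl | rfl
      · exact hgmem
      · exact hhmem)
    omega
  obtain ⟨p, hlen, hp⟩ := h _ hn g hgmem _ hhmem hdist
  have := le_length_of_support_subset_cayleyBall hX hb hK p hp
  omega

theorem theorem4p2 (j : ℕ) (hj : 1 ≤ j) (i : Fin j → ℕ) (hi : StrictMono i)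
    (hi_one : ∀ m : Fin j, 1 < i m) :
    ¬ IsMinimallyAlmostConvex
      ({ThompsonF.x 0, ThompsonF.x 1} ∪ Set.range (fun m : Fin j => ThompsonF.x (i m))) := by
  have hK := hi_one ⟨j - 1, by omega⟩
  refine not_isMinimallyAlmostConvex (K := i ⟨j - 1, by omega⟩) hK.le ?_ (by simp) (by simp)
    (Or.inr ⟨_, rfl⟩)
  rintro s ((rfl | rfl) | ⟨m, rfl⟩)
  · exact ⟨0, Nat.zero_le _, rfl⟩
  · exact ⟨1, hK.le, rfl⟩
  · refine ⟨i m, hi.monotone ?_, rfl⟩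
    rw [Fin.le_def]
    have := m.2
    dsimp only
    omega
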